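/- For $n\ge 1$ let $$M_n=\{a^{kd} \mid k\ge 0,\ 1<d\le 2^n(n+1)+1\}$$ be a language over the one-letter alphabet $\{a\}$. A one-way nondeterministic finite automaton (1NFA) has a finite set of states, exactly one initial state, a set of final states, and transitions each of which reads one input letter; it accepts a word if some computation from the initial state reads the whole word and ends in a final state. For $k\ge 1$ let $k\#=\prod_{p\le k,\ p\text{ prime}}p$ denote the primorial of $k$. Then, for each $n\ge1$: 1. There is a 1NFA recognizing $M_n$ with exactly $$1+\sum_{\substack{p\le 2^n(n+1)+1\\ p\text{ prime}}}p$$ states, whose initial state has no incoming transition and hence lies on no cycle. 2. Every 1NFA recognizing $a^*\setminus M_n$ has at least $(2^n(n+1)+1)\#$ states, and $(2^n(n+1)+1)\#>2^{2^n n}$; hence it has more than $2^{2^n n}$ states. -/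

import Mathlib

/-- The unary language `M_n = {a^(k d) | k ≥ 0, 1 < d ≤ 2 ^ n * (n + 1) + 1}` over the one-letter
alphabet `{a}`, which is modelled by `Unit`; the word `a^m` is `List.replicate m ()`. -/
def langM (n : ℕ) : Language Unit :=
  {w | ∃ k d : ℕ, 1 < d ∧ d ≤ 2 ^ n * (n + 1) + 1 ∧ w = List.replicate (k * d) ()}

/-- The complement `a* \ M_n`. Every list over `Unit` is a word of `a*`. -/
def langMCompl (n : ℕ) : Language Unit := {w | w ∉ langM n}

/-- The sum of all primes `p ≤ k`. -/
def primeSum (k : ℕ) : ℕ := ∑ p ∈ Finset.range (k + 1) with p.Prime, p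

/-- A one-way nondeterministic automaton with initial state `q₀` recognizing the language `L`.
Mathlib's `NFA` allows a set of initial states, which here is required to be the singleton `{q₀}`;
Mathlib's `NFA` has no spontaneous transitions. -/
def Recognizes1NFA {Q : Type*} (A : NFA Unit Q) (q₀ : Q) (L : Language Unit) : Prop :=
  A.start = {q₀} ∧ A.accepts = L

/-- No transition of the automaton enters the state `q`. -/
def NoIncoming {Q : Type*} (A : NFA Unit Q) (q : Q) : Prop :=
  ∀ (p : Q) (a : Unit), q ∉ A.step p a

/-- The state `q` lies on no cycle: no nonempty word leads from `q` back to `q`. -/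
def OnNoCycle {Q : Type*} (A : NFA Unit Q) (q : Q) : Prop :=
  ∀ w : List Unit, w ≠ [] → q ∉ A.evalFrom {q} w

/-! Put `K = 2 ^ n * (n + 1) + 1`. A word `a^m` lies in `M_n` iff some prime `p ≤ K` divides `m`, so
an automaton can guess `p` and count modulo `p`. For the complement, take a long accepted `a^m` and
pump it by a cycle length `l ≤ |Q|`. If a prime `p ≤ K` did not divide `l`, some `m + k * l` would
be a multiple of `p`, yet accepted. Hence the primorial of `K` divides `l`, so it is at most `|Q|`.
The numerical bound combines `2 ^ K ≤ (K + 1) * lcm(1, …, K)` with the fact that the lcm exceeds the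
primorial only through primes up to `√K`. -/

theorem replicate_mem_langM {n m : ℕ} :
    List.replicate m () ∈ langM n ↔ ∃ p, p.Prime ∧ p ≤ 2 ^ n * (n + 1) + 1 ∧ p ∣ m := by
  constructor
  · rintro ⟨k, d, hd, hdK, h⟩
    have hm : m = k * d := by simpa using congrArg List.length h
    exact ⟨d.minFac, Nat.minFac_prime hd.ne', (Nat.minFac_le (by lia)).trans hdK,
      hm ▸ (Nat.minFac_dvd d).mul_left k⟩
  · rintro ⟨p, hp, hpK, k, rfl⟩
    exact ⟨k, p, hp.one_lt, hpK, by rw [mul_comm]⟩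

theorem list_unit_eq_replicate (w : List Unit) : w = List.replicate w.length () :=
  List.eq_replicate_of_mem fun _ _ ↦ rfl

namespace NFA

variable {α σ : Type*} {M : NFA α σ} {a : α}

theorem mem_evalFrom_replicate_of_walk {f : ℕ → σ} {m : ℕ}
    (hf : ∀ i < m, f (i + 1) ∈ M.step (f i) a) {i j : ℕ} (hij : i ≤ j) (hj : j ≤ m) :
    f j ∈ M.evalFrom {f i} (List.replicate (j - i) a) := by
  induction j, hij using Nat.le_induction with
  | base => simp
  | succ j hij ih =>
    rw [Nat.sub_add_comm hij, List.replicate_succ', evalFrom_append, evalFrom_singleton,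
      mem_stepSet]
    exact ⟨f j, ih (by lia), hf j (by lia)⟩

theorem exists_walk_of_mem_evalFrom_replicate {S : Set σ} {m : ℕ} {t : σ}
    (h : t ∈ M.evalFrom S (List.replicate m a)) :
    ∃ f : ℕ → σ, f 0 ∈ S ∧ f m = t ∧ ∀ i < m, f (i + 1) ∈ M.step (f i) a := by
  induction m generalizing t with
  | zero => exact ⟨fun _ ↦ t, by simpa using h, rfl, by simp⟩
  | succ m ih =>
    rw [List.replicate_succ', evalFrom_append, evalFrom_singleton, mem_stepSet] at h
    obtain ⟨s, hs, hst⟩ := h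
    obtain ⟨f, hf0, hfm, hf⟩ := ih hs
    refine ⟨fun i ↦ if i ≤ m then f i else t, by simpa using hf0, by simp, fun i hi ↦ ?_⟩
    rcases (Nat.lt_succ_iff_lt_or_eq.mp hi) with hi | rfl
    · simpa [hi.le, Nat.succ_le_of_lt hi] using hf i hi
    · simpa [hfm] using hst

/-- A long accepted power of a letter can be pumped by the length of a cycle, which is at most the
number of states. -/
theorem exists_pumping_replicate [Fintype σ] {m : ℕ} (hm : Fintype.card σ ≤ m)
    (h : List.replicate m a ∈ M.accepts) :
    ∃ l, 0 < l ∧ l ≤ Fintype.card σ ∧ ∀ k, List.replicate (m + k * l) a ∈ M.accepts := by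
  obtain ⟨t, ht, hmt⟩ := mem_accepts.mp h
  obtain ⟨f, hf0, rfl, hf⟩ := exists_walk_of_mem_evalFrom_replicate hmt
  obtain ⟨i, j, hij, hfij⟩ : ∃ i j : Fin (Fintype.card σ + 1), i < j ∧ f i = f j := by
    obtain ⟨i, j, hne, he⟩ := Fintype.exists_ne_map_eq_of_card_lt
      (fun i : Fin (Fintype.card σ + 1) ↦ f i) (by simp)
    rcases hne.lt_or_gt with h | h
    exacts [⟨i, j, h, he⟩, ⟨j, i, h, he.symm⟩]
  have hij' : (i : ℕ) < j := hij
  have hjm : (j : ℕ) ≤ m := by lia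
  -- The original walk already turns once, so `k` counts the additional turns.
  have hcycle (k : ℕ) : f j ∈ M.evalFrom {f i} (List.replicate ((j - i : ℕ) + k * (j - i)) a) := by
    induction k with
    | zero => simpa using mem_evalFrom_replicate_of_walk hf hij'.le hjm
    | succ k ih =>
      rw [add_one_mul, ← add_assoc, List.replicate_add, evalFrom_append, mem_evalFrom_iff_exists]
      refine ⟨_, ih, ?_⟩
      rw [← hfij]
      exact hfij ▸ mem_evalFrom_replicate_of_walk hf hij'.le hjm
  refine ⟨j - i, by lia, by lia, fun k ↦ mem_accepts.mpr ⟨f m, ht, ?_⟩⟩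
  have hsplit : m + k * (j - i) = i + (((j - i : ℕ) + k * (j - i)) + (m - j)) := by
    generalize k * (j - i : ℕ) = x
    lia
  rw [hsplit, List.replicate_add, evalFrom_append, mem_evalFrom_iff_exists]
  refine ⟨f i, mem_evalFrom_iff_exists.mpr ⟨f 0, hf0, ?_⟩, ?_⟩
  · simpa using mem_evalFrom_replicate_of_walk hf (Nat.zero_le i) (by lia)
  · rw [List.replicate_add, evalFrom_append, mem_evalFrom_iff_exists]
    exact ⟨f j, hcycle k, mem_evalFrom_replicate_of_walk hf hjm le_rfl⟩

end NFA

/-- Since `l` is invertible modulo `p`, take `k ≡ -m / l`. -/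
theorem exists_dvd_add_mul {p l : ℕ} (hp : p.Prime) (hl : ¬ p ∣ l) (m : ℕ) :
    ∃ k, p ∣ m + k * l := by
  have := Fact.mk hp
  have hl' : (l : ZMod p) ≠ 0 := by rwa [Ne, ZMod.natCast_eq_zero_iff]
  refine ⟨(-(m : ZMod p) / l).val, ?_⟩
  rw [← ZMod.natCast_eq_zero_iff]
  push_cast
  rw [ZMod.natCast_zmod_val, div_mul_cancel₀ _ hl', add_neg_cancel]

theorem primorial_dvd_of_forall_prime_dvd {K l : ℕ} (h : ∀ p, p.Prime → p ≤ K → p ∣ l) :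
    primorial K ∣ l := by
  refine Finset.prod_primes_dvd l (fun p hp ↦ ?_) fun p hp ↦ ?_
  · exact (Finset.mem_filter.mp hp).2.prime
  · rw [Finset.mem_filter, Finset.mem_range] at hp
    exact h p hp.2 (by lia)

theorem primorial_le_card_of_accepts_eq_langMCompl {Q : Type*} [Fintype Q] {A : NFA Unit Q}
    {n : ℕ} (hA : A.accepts = langMCompl n) :
    primorial (2 ^ n * (n + 1) + 1) ≤ Fintype.card Q := by
  set K := 2 ^ n * (n + 1) + 1 with hK
  have hmem (m : ℕ) : List.replicate m () ∈ A.accepts ↔ ∀ p, p.Prime → p ≤ K → ¬ p ∣ m := by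
    rw [hA]
    refine (not_congr replicate_mem_langM).trans ?_
    push Not
    rfl
  -- This length is at least `|Q|` and is 1 modulo every prime up to `K`.
  have hlong : Fintype.card Q ≤ primorial K * Fintype.card Q + 1 :=
    (Nat.le_mul_of_pos_left _ (primorial_pos K)).trans (Nat.le_succ _)
  obtain ⟨l, hl0, hl, hpump⟩ := NFA.exists_pumping_replicate hlong <| (hmem _).mpr
    fun p hp hpK hdvd ↦ hp.one_lt.ne' <| Nat.dvd_one.mp <|
      (Nat.dvd_add_right ((hp.dvd_primorial_iff.mpr hpK).mul_right _)).mp hdvd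
  refine (Nat.le_of_dvd hl0 <| primorial_dvd_of_forall_prime_dvd fun p hp hpK ↦ ?_).trans hl
  by_contra hpl
  obtain ⟨k, hk⟩ := exists_dvd_add_mul hp hpl (primorial K * Fintype.card Q + 1)
  exact (hmem _).mp (hpump k) p hp hpK hk

/-- The automaton that guesses an element `p` of `s` with its first letter and then counts modulo
`p`. Its initial state `none` accepts the empty word. -/
def cyclesNFA (s : Finset ℕ) : NFA Unit (Option (Σ p : s, ZMod p)) where
  step q _ := match q with
    | none => {r | ∃ p : s, r = some ⟨p, 1⟩}
    | some ⟨p, i⟩ => {some ⟨p, i + 1⟩}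
  start := {none}
  accept := {q | q = none ∨ ∃ p : s, q = some ⟨p, 0⟩}

theorem noIncoming_cyclesNFA (s : Finset ℕ) : NoIncoming (cyclesNFA s) none := by
  rintro (_ | ⟨p, i⟩) a <;> simp [cyclesNFA]

theorem NoIncoming.onNoCycle {Q : Type*} {A : NFA Unit Q} {q : Q} (h : NoIncoming A q) :
    OnNoCycle A q := by
  intro w hw hq
  rw [← List.dropLast_append_getLast hw, NFA.evalFrom_append, NFA.evalFrom_singleton,
    NFA.mem_stepSet] at hq
  obtain ⟨t, -, ht⟩ := hq
  exact h t _ ht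

theorem evalFrom_cyclesNFA_replicate_succ (s : Finset ℕ) (m : ℕ) :
    (cyclesNFA s).evalFrom {none} (List.replicate (m + 1) ()) =
      {r | ∃ p : s, r = some ⟨p, (m + 1 : ℕ)⟩} := by
  induction m with
  | zero =>
    ext r
    simp [cyclesNFA]
  | succ m ih =>
    rw [List.replicate_succ', NFA.evalFrom_append, ih, NFA.evalFrom_singleton]
    ext r
    rw [NFA.mem_stepSet]
    constructor
    · rintro ⟨_, ⟨p, rfl⟩, h⟩
      exact ⟨p, by simpa [cyclesNFA] using h⟩
    · rintro ⟨p, rfl⟩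
      exact ⟨_, ⟨p, rfl⟩, by simp [cyclesNFA]⟩

theorem replicate_mem_accepts_cyclesNFA {s : Finset ℕ} {m : ℕ} :
    List.replicate m () ∈ (cyclesNFA s).accepts ↔ m = 0 ∨ ∃ p ∈ s, p ∣ m := by
  rw [NFA.mem_accepts]
  change (∃ q ∈ (cyclesNFA s).accept, q ∈ (cyclesNFA s).evalFrom {none} _) ↔ _
  rcases m with _ | m
  · simp [cyclesNFA]
  · rw [evalFrom_cyclesNFA_replicate_succ]
    constructor
    · rintro ⟨_, h | ⟨p, h⟩, ⟨q, rfl⟩⟩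
      · cases h
      · obtain ⟨rfl, h⟩ := Sigma.mk.inj (Option.some.inj h)
        exact .inr ⟨q, q.2, (ZMod.natCast_eq_zero_iff _ _).mp (eq_of_heq h)⟩
    · rintro (h | ⟨p, hp, h⟩)
      · cases h
      · exact ⟨_, .inr ⟨⟨p, hp⟩, rfl⟩, ⟨p, hp⟩, by rw [(ZMod.natCast_eq_zero_iff _ _).mpr h]⟩

theorem exists_recognizes1NFA_langM (n : ℕ) :
    ∃ (Q : Type) (_ : Fintype Q) (A : NFA Unit Q) (q₀ : Q),
      Recognizes1NFA A q₀ (langM n) ∧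
      Fintype.card Q = primeSum (2 ^ n * (n + 1) + 1) + 1 ∧
      NoIncoming A q₀ ∧ OnNoCycle A q₀ := by
  let s := {p ∈ Finset.range (2 ^ n * (n + 1) + 1 + 1) | p.Prime}
  have hs (p : ℕ) : p ∈ s ↔ p ≤ 2 ^ n * (n + 1) + 1 ∧ p.Prime := by
    rw [Finset.mem_filter, Finset.mem_range, Nat.lt_succ_iff]
  -- `ZMod 0` is `ℤ`, so finiteness of the state set needs `p ≠ 0`.
  have (p : s) : NeZero (p : ℕ) := ⟨((hs p).mp p.2).2.ne_zero⟩
  refine ⟨Option (Σ p : s, ZMod p), inferInstance, cyclesNFA s, none, ⟨rfl, ?_⟩, ?_,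
    noIncoming_cyclesNFA s, (noIncoming_cyclesNFA s).onNoCycle⟩
  · ext w
    rw [list_unit_eq_replicate w, replicate_mem_accepts_cyclesNFA, replicate_mem_langM]
    constructor
    · rintro (h | ⟨p, hp, h⟩)
      · have : 0 < 2 ^ n * (n + 1) := by positivity
        exact ⟨2, Nat.prime_two, by lia, h ▸ dvd_zero 2⟩
      · exact ⟨p, ((hs p).mp hp).2, ((hs p).mp hp).1, h⟩
    · rintro ⟨p, hp, hpK, h⟩
      exact .inr ⟨p, (hs p).mpr ⟨hpK, hp⟩, h⟩
  · rw [Fintype.card_option, Fintype.card_sigma]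
    simp_rw [ZMod.card]
    rw [Finset.sum_coe_sort s fun p ↦ p]
    rfl

/-- A prime above `√N` enters the lcm with exponent at most 1; any other contributes a power at most
`N`. -/
theorem lcmUpto_le_primorial_mul_pow {N : ℕ} (hN : N ≠ 0) :
    Nat.lcmUpto N ≤ primorial N * N ^ (Nat.primesLE N.sqrt).card := by
  have hsub : {p ∈ Nat.primesLE N | p ≤ N.sqrt} ⊆ Nat.primesLE N.sqrt := by
    intro p hp
    rw [Finset.mem_filter, Nat.mem_primesLE] at hp
    exact Nat.mem_primesLE.mpr ⟨hp.2, hp.1.2⟩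
  calc Nat.lcmUpto N = ∏ p ∈ Nat.primesLE N, p ^ p.log N := Nat.lcmUpto_eq_prod_pow_log N
    _ ≤ ∏ p ∈ Nat.primesLE N, p * if p ≤ N.sqrt then N else 1 := by
      refine Finset.prod_le_prod' fun p hp ↦ ?_
      have hp := (Nat.mem_primesLE.mp hp).2
      split_ifs with h
      · exact (Nat.pow_log_le_self p hN).trans (Nat.le_mul_of_pos_left N hp.pos)
      · have hlog : p.log N < 2 :=
          Nat.log_lt_of_lt_pow hN (by rw [sq]; exact Nat.sqrt_lt.mp (not_le.mp h))
        rw [mul_one]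
        exact (Nat.pow_le_pow_right hp.pos (Nat.lt_succ_iff.mp hlog)).trans_eq (pow_one p)
    _ = primorial N * N ^ {p ∈ Nat.primesLE N | p ≤ N.sqrt}.card := by
      rw [Finset.prod_mul_distrib, primorial_eq_prod_primesLE, ← Finset.prod_filter,
        Finset.prod_const]
    _ ≤ _ := by
      gcongr
      exact Nat.pos_of_ne_zero hN

/-- The parameter `c` admits either the exact prime count or a crude bound. The exponent `2 ^ n + 1`
is what remains of `N` after removing `2 ^ n * n`. -/
theorem two_pow_lt_primorial_of_lt {n c : ℕ}
    (hc : (Nat.primesLE (Nat.sqrt (2 ^ n * (n + 1) + 1))).card ≤ c)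
    (h : (2 ^ n * (n + 1) + 2) * (2 ^ n * (n + 1) + 1) ^ c < 2 ^ (2 ^ n + 1)) :
    2 ^ (2 ^ n * n) < primorial (2 ^ n * (n + 1) + 1) := by
  set N := 2 ^ n * (n + 1) + 1 with hN
  have hlcm : Nat.lcmUpto N ≤ primorial N * N ^ c :=
    (lcmUpto_le_primorial_mul_pow (by lia)).trans (by gcongr; lia)
  have hlow : 2 ^ (2 ^ n * n) * 2 ^ (2 ^ n + 1) ≤ primorial N * ((N + 1) * N ^ c) := calc
    _ = 2 ^ N := by rw [← pow_add]; congr 1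
    _ ≤ (N + 1) * Nat.lcmUpto N := Chebyshev.two_pow_le_mul_lcmUpto N
    _ ≤ (N + 1) * (primorial N * N ^ c) := by gcongr
    _ = _ := by ring
  by_contra! hcon
  exact (hlow.trans (Nat.mul_le_mul_right _ hcon)).not_gt
    (Nat.mul_lt_mul_of_pos_left h (by positivity))

theorem card_primesLE_le (s : ℕ) : (Nat.primesLE s).card ≤ s := by
  have : Nat.primesLE s ⊆ Finset.Icc 1 s := by
    intro p hp
    rw [Nat.mem_primesLE] at hp
    exact Finset.mem_Icc.mpr ⟨hp.2.one_le, hp.1⟩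
  simpa using Finset.card_le_card this

theorem four_mul_sq_mul_add_two_le_two_pow {n : ℕ} (hn : 14 ≤ n) :
    4 * n ^ 2 * (n + 2) ≤ 2 ^ n := by
  induction n, hn using Nat.le_induction with
  | base => norm_num
  | succ n hn ih =>
    have hstep : 4 * (n + 1) ^ 2 * (n + 1 + 2) ≤ 4 * n ^ 2 * (n + 2) * 2 := by
      -- With `n = 14 + k` both sides are polynomials in `k`, compared coefficientwise.
      obtain ⟨k, rfl⟩ := Nat.exists_eq_add_of_le hn
      ring_nf
      gcongr <;> norm_num
    rw [pow_succ]
    exact hstep.trans (Nat.mul_le_mul_right 2 ih)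

/-- Here the trivial bound `π(s) ≤ s` suffices, as `s` is only about `√(2 ^ n * n)`. -/
theorem two_pow_lt_primorial_of_fourteen_le {n : ℕ} (hn : 14 ≤ n) :
    2 ^ (2 ^ n * n) < primorial (2 ^ n * (n + 1) + 1) := by
  have hpow := four_mul_sq_mul_add_two_le_two_pow hn
  have hlin : 4 * 14 * 14 * (n + 2) ≤ 2 ^ n := hpow.trans' (by rw [sq, ← mul_assoc]; gcongr)
  refine two_pow_lt_primorial_of_lt (card_primesLE_le _) ?_
  set s := Nat.sqrt (2 ^ n * (n + 1) + 1) with hs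
  have hsq : s * s ≤ 2 ^ n * (n + 1) + 1 := Nat.sqrt_le _
  have hs2 : 2 * s + 2 ≤ 2 ^ n := by nlinarith
  -- Squaring both sides makes `s * s ≤ N` usable.
  have hs1 : 2 * n * (s + 1) ≤ 2 ^ n := by
    refine Nat.mul_self_le_mul_self_iff.mp ?_
    calc 2 * n * (s + 1) * (2 * n * (s + 1)) = 4 * n ^ 2 * (s * s + (2 * s + 1)) := by ring
      _ ≤ 4 * n ^ 2 * (2 ^ n * (n + 2)) := by gcongr; lia
      _ = 4 * n ^ 2 * (n + 2) * 2 ^ n := by ring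
      _ ≤ 2 ^ n * 2 ^ n := by gcongr
  have hN : 2 ^ n * (n + 1) + 2 ≤ 2 ^ (2 * n) := by
    rw [two_mul, pow_add]
    nlinarith
  calc (2 ^ n * (n + 1) + 2) * (2 ^ n * (n + 1) + 1) ^ s
      ≤ 2 ^ (2 * n) * (2 ^ (2 * n)) ^ s := by gcongr; lia
    _ = 2 ^ (2 * n * (s + 1)) := by rw [← pow_mul, ← pow_add]; ring_nf
    _ < 2 ^ (2 ^ n + 1) := Nat.pow_lt_pow_right one_lt_two (by lia)

theorem two_pow_lt_primorial {n : ℕ} (hn : 1 ≤ n) :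
    2 ^ (2 ^ n * n) < primorial (2 ^ n * (n + 1) + 1) := by
  rcases le_or_gt 14 n with h | h
  · exact two_pow_lt_primorial_of_fourteen_le h
  rcases le_or_gt 7 n with h7 | h7
  -- The exact count of primes up to `√N` is used here; at `n = 6` even this fails, so smaller cases
  -- evaluate the primorial itself.
  · refine two_pow_lt_primorial_of_lt le_rfl ?_
    clear hn
    interval_cases n <;> decide +kernel
  · clear h
    interval_cases n <;> decide +kernel

theorem mainTheorem5 (n : ℕ) (hn : 1 ≤ n) :
    (∃ (Q : Type) (_ : Fintype Q) (A : NFA Unit Q) (q₀ : Q),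
      Recognizes1NFA A q₀ (langM n) ∧
      Fintype.card Q = primeSum (2 ^ n * (n + 1) + 1) + 1 ∧
      NoIncoming A q₀ ∧ OnNoCycle A q₀) ∧
    (∀ (Q : Type*) [Fintype Q] (A : NFA Unit Q) (q₀ : Q),
      Recognizes1NFA A q₀ (langMCompl n) →
      primorial (2 ^ n * (n + 1) + 1) ≤ Fintype.card Q) ∧
    2 ^ (2 ^ n * n) < primorial (2 ^ n * (n + 1) + 1) :=
  ⟨exists_recognizes1NFA_langM n,
    fun _ _ _ _ h ↦ primorial_le_card_of_accepts_eq_langMCompl h.2, two_pow_lt_primorial hn⟩
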